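/- Let $\tau,\Omega>0$, let $\mathrm{SRF}=\frac{\pi}{\tau\Omega}$ be the superresolution factor, and assume $\mathrm{SRF}>2$. For $j\in\mathbb{Z}$ let $a_j(\omega)=\frac{e^{ij\tau\omega}}{\sqrt{2\Omega}}$, $\omega\in[-\Omega,\Omega]$, viewed as a unit vector of $L^2([-\Omega,\Omega];\mathbb{C})$. Let $k\ge 1$ be an integer, let $J\subset\mathbb{Z}$ be a finite set of grid indices that contains $2k$ consecutive integers (for instance $J=\{0,1,\dots,N-1\}$ with $N\ge 2k$), let $\mathbb{K}$ be $\mathbb{R}$ or $\mathbb{C}$, and put $Ax=\sum_{j\in J}x_ja_j$ for $x\in\mathbb{K}^J$. Denote by $\|x\|$ the Euclidean norm and by $\|x\|_0$ the number of nonzero entries of $x$. For $\sigma>0$ define the minimax error $$E(k,\sigma)=\inf_{\tilde x}\ \sup_{x_0\in\mathbb{K}^J:\ \|x_0\|_0=k}\ \ \sup_{e:\ \|e\|_{L^2}=\sigma}\ \|\tilde x(Ax_0+e)-x_0\|,$$ where the infimum runs over all functions $\tilde x:L^2([-\Omega,\Omega];\mathbb{C})\to\mathbb{K}^J$ and $e$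 over $L^2([-\Omega,\Omega];\mathbb{C})$. For every $k\ge1$ there are constants $C_{1,k},C_{2,k}>0$, depending only on $k$, such that for all $\tau$, $\Omega$, $J$, $\mathbb{K}$ as above and all $\sigma>0$, $$C_{1,k}\,(\mathrm{SRF})^{2k-1}\,\sigma\ \le\ E(k,\sigma)\ \le\ C_{2,k}\,(\mathrm{SRF})^{2k-1}\,\sigma .$$ The same inequalities hold, with the same constants, if the condition $\|e\|_{L^2}=\sigma$ in the definition of $E(k,\sigma)$ is replaced by $\|e\|_{L^2}\le\sigma$. -/

import Mathlib

open MeasureTheory Set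
open scoped ENNReal

noncomputable section

namespace Superresolution

/-- The data space `L²([-Ω, Ω]; ℂ)`, with respect to Lebesgue measure. -/
abbrev DataSpace (Ω : ℝ) : Type :=
  Lp ℂ 2 (volume.restrict (Icc (-Ω) Ω))

/-- The atom `a_j(ω) = exp(i j τ ω) / √(2Ω)`, as a function of the frequency `ω`. -/
def atomFun (τ Ω : ℝ) (j : ℤ) (ω : ℝ) : ℂ :=
  Complex.exp (Complex.I * (j : ℂ) * (τ : ℂ) * (ω : ℂ)) / ((Real.sqrt (2 * Ω) : ℝ) : ℂ)

theorem continuous_atomFun (τ Ω : ℝ) (j : ℤ) : Continuous (atomFun τ Ω j) := by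
  unfold atomFun
  fun_prop

theorem memLp_atomFun (τ Ω : ℝ) (j : ℤ) :
    MemLp (atomFun τ Ω j) 2 (volume.restrict (Icc (-Ω) Ω)) := by
  refine MemLp.of_bound (continuous_atomFun τ Ω j).aestronglyMeasurable
    (1 / Real.sqrt (2 * Ω)) (Filter.Eventually.of_forall fun ω => le_of_eq ?_)
  have h : Complex.I * (j : ℂ) * (τ : ℂ) * (ω : ℂ) = (((j : ℝ) * τ * ω : ℝ) : ℂ) * Complex.I := by
    push_cast
    ring
  rw [atomFun, norm_div, h, Complex.norm_exp_ofReal_mul_I, Complex.norm_real,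
    Real.norm_of_nonneg (Real.sqrt_nonneg _)]

/-- The atom `a_j` as an element of `L²([-Ω, Ω]; ℂ)`. -/
def atom (τ Ω : ℝ) (j : ℤ) : DataSpace Ω :=
  (memLp_atomFun τ Ω j).toLp (atomFun τ Ω j)

/-- The synthesis operator `A x = ∑_{j ∈ J} x_j a_j` of the partial Fourier system whose columns
are indexed by the finite set `J` of grid indices.  The coefficients lie in `𝕜`, which is used
below with `𝕜 = ℝ` and `𝕜 = ℂ`. -/
def synthesis {𝕜 : Type} [RCLike 𝕜] [NormedSpace 𝕜 ℂ] (τ Ω : ℝ) (J : Finset ℤ)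
    (x : EuclideanSpace 𝕜 J) : DataSpace Ω :=
  ∑ j : J, x j • atom τ Ω (j : ℤ)

/-- `‖x‖₀`, the number of nonzero entries of `x`. -/
def sparsity {𝕜 : Type} [RCLike 𝕜] {J : Finset ℤ} (x : EuclideanSpace 𝕜 J) : ℕ :=
  {j : J | x j ≠ 0}.ncard

/-- The minimax error for recovering a coefficient vector `x` with `‖x‖₀ = k` from `f = A x + e`,
where the noise `e` ranges over the class `noise`: the infimum over all estimators
(arbitrary functions of the data `f`) of the worst-case `ℓ²` error. Its values are in `[0, ∞]`. -/
def minimaxError (𝕜 : Type) [RCLike 𝕜] [NormedSpace 𝕜 ℂ] (τ Ω : ℝ) (J : Finset ℤ) (k : ℕ)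
    (noise : Set (DataSpace Ω)) : ℝ≥0∞ :=
  ⨅ est : DataSpace Ω → EuclideanSpace 𝕜 J,
    ⨆ x : EuclideanSpace 𝕜 J, ⨆ _ : sparsity x = k,
      ⨆ e : DataSpace Ω, ⨆ _ : e ∈ noise,
        ENNReal.ofReal ‖est (synthesis τ Ω J x + e) - x‖

/-- `E(k, σ)`: the minimax error over noise of norm exactly `σ`. -/
def minimaxErrorEq (𝕜 : Type) [RCLike 𝕜] [NormedSpace 𝕜 ℂ] (τ Ω : ℝ) (J : Finset ℤ) (k : ℕ)
    (σ : ℝ) : ℝ≥0∞ :=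
  minimaxError 𝕜 τ Ω J k {e | ‖e‖ = σ}

/-- The variant of `E(k, σ)` over noise of norm at most `σ`. -/
def minimaxErrorLe (𝕜 : Type) [RCLike 𝕜] [NormedSpace 𝕜 ℂ] (τ Ω : ℝ) (J : Finset ℤ) (k : ℕ)
    (σ : ℝ) : ℝ≥0∞ :=
  minimaxError 𝕜 τ Ω J k {e | ‖e‖ ≤ σ}

/-- The superresolution factor `SRF = π / (τ Ω)`. -/
def SRF (τ Ω : ℝ) : ℝ :=
  Real.pi / (τ * Ω)

/-- The two-sided bound `C₁ SRF^(2k-1) σ ≤ E ≤ C₂ SRF^(2k-1) σ` for a quantity `E ∈ [0, ∞]`. -/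
def ScalesLike (C₁ C₂ τ Ω : ℝ) (k : ℕ) (σ : ℝ) (E : ℝ≥0∞) : Prop :=
  ENNReal.ofReal (C₁ * SRF τ Ω ^ (2 * k - 1) * σ) ≤ E ∧
    E ≤ ENNReal.ofReal (C₂ * SRF τ Ω ^ (2 * k - 1) * σ)

end Superresolution

end

/-! Everything rests on how small `‖A u‖` can be for a `2k`-sparse `u`: down to order `SRF ^
(-(2k-1)) * ‖u‖`, and no further. Upper bound: the difference of two `k`-sparse vectors that explain
the same data within `σ` is `2k`-sparse with image of norm at most `2σ`. For `2k`-sparse `u`, `A u`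
is, up to normalisation, a trigonometric polynomial with at most `2k` terms. Cut `[-Ω, Ω]` into `2k`
cells; Turán's lemma (`norm_sum_pow_mul_le`) bounds the polynomial on the `p`-th translated cell by
its values on these, with growth `p ^ (2k-1)`. Squaring and summing over the cells covering a full
period, where Parseval gives `‖u‖`, yields `norm_le_norm_synthesis`. Lower bound: binomial
coefficients with alternating signs on `2k` consecutive indices give `(1 - exp(iτω)) ^ (2k-1)` up to
a phase, of size at most `(τΩ) ^ (2k-1)`. The two halves of this vector produce two `k`-sparse
signals that noise of norm `σ` makes indistinguishable. -/

namespace Superresolution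

/-! ### Turán's lemma -/

/-- Turán's lemma: a sum of at most `m + 1` geometric progressions with unimodular ratios is
controlled by its first `m + 1` values, with polynomial growth of degree `m`. -/
theorem norm_sum_pow_mul_le {ι : Type*} [DecidableEq ι] (z : ι → ℂ) (hz : ∀ j, ‖z j‖ = 1) (m : ℕ) :
    ∀ (s : Finset ι) (w : ι → ℂ), s.card ≤ m + 1 → ∀ p : ℕ,
      ‖∑ j ∈ s, z j ^ p * w j‖ ≤
        2 ^ (m + 1) * ((p : ℝ) + 1) ^ m *
          ∑ l ∈ Finset.range (m + 1), ‖∑ j ∈ s, z j ^ l * w j‖ := by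
  induction m with
  | zero =>
    intro s w hs p
    rcases s.eq_empty_or_nonempty with rfl | hne
    · simp
    · obtain ⟨a, rfl⟩ := Finset.card_eq_one.1 (le_antisymm hs hne.card_pos)
      simp only [Finset.sum_singleton, norm_mul, norm_pow, hz]
      simp only [one_pow, one_mul, zero_add, Finset.range_one, Finset.sum_singleton]
      have := norm_nonneg (w a)
      linarith
  | succ m ih =>
    intro s w hs p
    rcases s.eq_empty_or_nonempty with rfl | ⟨a, ha⟩
    · simp
    set v : ℕ → ℂ := fun p => ∑ j ∈ s, z j ^ p * w j with hv
    set V : ℝ := ∑ l ∈ Finset.range (m + 1 + 1), ‖v l‖ with hV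
    -- Applying the shift minus `z a` annihilates the progression with ratio `z a` and only
    -- reweights the others, so induction applies with one term fewer.
    have hstep : ∀ q, ∑ j ∈ s.erase a, z j ^ q * ((z j - z a) * w j) = v (q + 1) - z a * v q := by
      intro q
      rw [Finset.sum_erase _ (by simp), hv]
      simp only
      rw [Finset.mul_sum, ← Finset.sum_sub_distrib]
      exact Finset.sum_congr rfl fun j _ => by ring
    have hcard : (s.erase a).card ≤ m + 1 := by
      rw [Finset.card_erase_of_mem ha]
      omega
    have hsum : ∑ l ∈ Finset.range (m + 1), ‖v (l + 1) - z a * v l‖ ≤ 2 * V := by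
      calc ∑ l ∈ Finset.range (m + 1), ‖v (l + 1) - z a * v l‖
          ≤ ∑ l ∈ Finset.range (m + 1), (‖v (l + 1)‖ + ‖v l‖) := by
            refine Finset.sum_le_sum fun l _ => (norm_sub_le _ _).trans ?_
            rw [norm_mul, hz, one_mul]
        _ ≤ V + V := by
            rw [Finset.sum_add_distrib]
            refine add_le_add ?_ ?_
            · rw [hV, Finset.sum_range_succ' _ (m + 1)]
              exact le_add_of_nonneg_right (norm_nonneg _)
            · rw [hV, Finset.sum_range_succ _ (m + 1)]
              exact le_add_of_nonneg_right (norm_nonneg _)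
        _ = 2 * V := by ring
    have hV0 : 0 ≤ V := Finset.sum_nonneg fun _ _ => norm_nonneg _
    have hg : ∀ q, ‖v (q + 1) - z a * v q‖ ≤ 2 ^ (m + 2) * ((q : ℝ) + 1) ^ m * V := by
      intro q
      have := ih (s.erase a) (fun j => (z j - z a) * w j) hcard q
      simp only [hstep] at this
      calc _ ≤ _ := this
        _ ≤ 2 ^ (m + 1) * ((q : ℝ) + 1) ^ m * (2 * V) := by gcongr
        _ = _ := by ring
    -- Since `‖z a‖ = 1`, each step increases `‖v p‖` by at most the norm of the difference bounded
    -- in `hg`; summing `p` steps costs one degree in `p`.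
    have hmain : ∀ p : ℕ, ‖v p‖ ≤ V + p * (2 ^ (m + 2) * ((p : ℝ) + 1) ^ m * V) := by
      intro p
      induction p with
      | zero =>
        simp only [Nat.cast_zero, zero_mul, add_zero]
        exact Finset.single_le_sum (f := fun l => ‖v l‖) (fun _ _ => norm_nonneg _)
          (Finset.mem_range.2 (Nat.succ_pos _))
      | succ p ihp =>
        have h1 : ‖v (p + 1)‖ ≤ ‖v (p + 1) - z a * v p‖ + ‖v p‖ := by
          have := norm_add_le (v (p + 1) - z a * v p) (z a * v p)
          rwa [sub_add_cancel, norm_mul, hz, one_mul] at this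
        have h2 : 2 ^ (m + 2) * ((p : ℝ) + 1) ^ m * V ≤
            2 ^ (m + 2) * (((p + 1 : ℕ) : ℝ) + 1) ^ m * V := by
          gcongr
          simp
        have h3 := mul_le_mul_of_nonneg_left h2 (Nat.cast_nonneg (α := ℝ) p)
        have h4 := hg p
        rw [Nat.cast_succ] at *
        linarith
    have h1 : (1 : ℝ) ≤ 2 ^ (m + 2) * ((p : ℝ) + 1) ^ m :=
      one_le_mul_of_one_le_of_one_le (one_le_pow₀ (by norm_num))
        (one_le_pow₀ (by linarith [Nat.cast_nonneg (α := ℝ) p]))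
    calc ‖v p‖ ≤ V + p * (2 ^ (m + 2) * ((p : ℝ) + 1) ^ m * V) := hmain p
      _ ≤ 2 ^ (m + 2) * ((p : ℝ) + 1) ^ m * V + p * (2 ^ (m + 2) * ((p : ℝ) + 1) ^ m * V) := by
          have := mul_le_mul_of_nonneg_right h1 hV0
          linarith
      _ = 2 ^ (m + 1 + 1) * ((p : ℝ) + 1) ^ (m + 1) * V := by ring

/-! ### Trigonometric polynomials: from the window to a full period -/

/-- The trigonometric polynomial with coefficients `c` at the frequencies `j τ`. -/
noncomputable def trigPoly (τ : ℝ) (s : Finset ℤ) (c : ℤ → ℂ) (ω : ℝ) : ℂ :=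
  ∑ j ∈ s, c j * Complex.exp (Complex.I * (j : ℂ) * (τ : ℂ) * (ω : ℂ))

theorem continuous_trigPoly (τ : ℝ) (s : Finset ℤ) (c : ℤ → ℂ) : Continuous (trigPoly τ s c) := by
  unfold trigPoly
  fun_prop

theorem trigPoly_add_mul (τ : ℝ) (s : Finset ℤ) (c : ℤ → ℂ) (ω h : ℝ) (p : ℕ) :
    trigPoly τ s c (ω + p * h) =
      ∑ j ∈ s, Complex.exp (Complex.I * (j : ℂ) * (τ : ℂ) * (h : ℂ)) ^ p *
        (c j * Complex.exp (Complex.I * (j : ℂ) * (τ : ℂ) * (ω : ℂ))) := by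
  refine Finset.sum_congr rfl fun j _ => ?_
  rw [← Complex.exp_nat_mul, mul_left_comm, ← Complex.exp_add]
  push_cast
  ring_nf

theorem norm_exp_I_mul_int_mul (τ ω : ℝ) (j : ℤ) :
    ‖Complex.exp (Complex.I * (j : ℂ) * (τ : ℂ) * (ω : ℂ))‖ = 1 := by
  have h : Complex.I * (j : ℂ) * (τ : ℂ) * (ω : ℂ) = (((j : ℝ) * τ * ω : ℝ) : ℂ) * Complex.I := by
    push_cast
    ring
  rw [h, Complex.norm_exp_ofReal_mul_I]

theorem normSq_trigPoly_add_mul_le (τ : ℝ) (s : Finset ℤ) (c : ℤ → ℂ) (ω h : ℝ) (p m : ℕ)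
    (hs : s.card ≤ m + 1) :
    ‖trigPoly τ s c (ω + p * h)‖ ^ 2 ≤
      4 ^ (m + 1) * ((p : ℝ) + 1) ^ (2 * m) * ((m : ℝ) + 1) *
        ∑ l ∈ Finset.range (m + 1), ‖trigPoly τ s c (ω + l * h)‖ ^ 2 := by
  have key := norm_sum_pow_mul_le (fun j : ℤ => Complex.exp (Complex.I * (j : ℂ) * (τ : ℂ) * (h : ℂ)))
    (fun j => norm_exp_I_mul_int_mul τ h j) m s
    (fun j => c j * Complex.exp (Complex.I * (j : ℂ) * (τ : ℂ) * (ω : ℂ))) hs p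
  simp only [← trigPoly_add_mul] at key
  have hcs := sq_sum_le_card_mul_sum_sq (s := Finset.range (m + 1))
    (f := fun l : ℕ => ‖trigPoly τ s c (ω + l * h)‖)
  rw [Finset.card_range, Nat.cast_succ] at hcs
  calc _ ≤ (2 ^ (m + 1) * ((p : ℝ) + 1) ^ m *
          ∑ l ∈ Finset.range (m + 1), ‖trigPoly τ s c (ω + l * h)‖) ^ 2 := by gcongr
    _ = 4 ^ (m + 1) * ((p : ℝ) + 1) ^ (2 * m) *
          (∑ l ∈ Finset.range (m + 1), ‖trigPoly τ s c (ω + l * h)‖) ^ 2 := by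
        rw [mul_pow, mul_pow, ← pow_mul, ← pow_mul, mul_comm (m + 1) 2, pow_mul 2 2, mul_comm m 2]
        norm_num
    _ ≤ 4 ^ (m + 1) * ((p : ℝ) + 1) ^ (2 * m) *
          (((m : ℝ) + 1) * ∑ l ∈ Finset.range (m + 1), ‖trigPoly τ s c (ω + l * h)‖ ^ 2) := by
        gcongr
    _ = _ := by ring

theorem sum_integral_shift {g : ℝ → ℝ} (hg : Continuous g) (b h : ℝ) (n : ℕ) :
    ∑ l ∈ Finset.range n, ∫ ω in b..b + h, g (ω + l * h) = ∫ ω in b..b + n * h, g ω := by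
  have := intervalIntegral.sum_integral_adjacent_intervals (f := g) (μ := volume)
    (a := fun l : ℕ => b + l * h) (n := n) fun l _ => hg.intervalIntegrable _ _
  simp only [Nat.cast_zero, zero_mul, add_zero] at this
  rw [← this]
  refine Finset.sum_congr rfl fun l _ => ?_
  rw [intervalIntegral.integral_comp_add_right g]
  congr 1
  push_cast
  ring

theorem integral_exp_period {τ : ℝ} (hτ : 0 < τ) (b : ℝ) (n : ℤ) :
    ∫ ω in b..b + 2 * Real.pi / τ, Complex.exp (Complex.I * (n : ℂ) * (τ : ℂ) * (ω : ℂ)) =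
      if n = 0 then ((2 * Real.pi / τ : ℝ) : ℂ) else 0 := by
  split_ifs with hn
  · subst hn
    simp
  · have hτ' : (τ : ℂ) ≠ 0 := by exact_mod_cast hτ.ne'
    have hn' : (n : ℂ) ≠ 0 := by exact_mod_cast hn
    rw [integral_exp_mul_complex (mul_ne_zero (mul_ne_zero Complex.I_ne_zero hn') hτ')]
    have : Complex.I * (n : ℂ) * (τ : ℂ) * ((b + 2 * Real.pi / τ : ℝ) : ℂ) =
        Complex.I * (n : ℂ) * (τ : ℂ) * (b : ℂ) + n * (2 * Real.pi * Complex.I) := by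
      push_cast
      field_simp
    rw [this, Complex.exp_periodic.int_mul n, sub_self, zero_div]

/-- Parseval's identity for trigonometric polynomials. -/
theorem integral_normSq_trigPoly {τ : ℝ} (hτ : 0 < τ) (s : Finset ℤ) (c : ℤ → ℂ) (b : ℝ) :
    ∫ ω in b..b + 2 * Real.pi / τ, ‖trigPoly τ s c ω‖ ^ 2 =
      2 * Real.pi / τ * ∑ j ∈ s, ‖c j‖ ^ 2 := by
  have hpt : ∀ ω : ℝ, ((‖trigPoly τ s c ω‖ ^ 2 : ℝ) : ℂ) = ∑ i ∈ s, ∑ j ∈ s,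
      c i * (starRingEnd ℂ) (c j) *
        Complex.exp (Complex.I * ((i - j : ℤ) : ℂ) * (τ : ℂ) * (ω : ℂ)) := by
    intro ω
    rw [Complex.ofReal_pow, ← Complex.mul_conj', trigPoly, map_sum, Finset.sum_mul_sum]
    refine Finset.sum_congr rfl fun i _ => Finset.sum_congr rfl fun j _ => ?_
    rw [map_mul, ← Complex.exp_conj, mul_mul_mul_comm, ← Complex.exp_add]
    simp only [map_mul, Complex.conj_I, Complex.conj_ofReal, map_intCast]
    push_cast
    ring_nf
  apply Complex.ofReal_injective
  rw [← intervalIntegral.integral_ofReal]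
  simp_rw [hpt]
  have hint : ∀ i j : ℤ, IntervalIntegrable (fun ω : ℝ => c i * (starRingEnd ℂ) (c j) *
      Complex.exp (Complex.I * ((i - j : ℤ) : ℂ) * (τ : ℂ) * (ω : ℂ))) volume
      b (b + 2 * Real.pi / τ) :=
    fun i j => (by fun_prop : Continuous _).intervalIntegrable _ _
  rw [intervalIntegral.integral_finsetSum
    fun i _ => by simpa only [Finset.sum_fn] using IntervalIntegrable.sum s fun j _ => hint i j]
  simp_rw [intervalIntegral.integral_finsetSum fun j _ => hint _ j,
    intervalIntegral.integral_const_mul, integral_exp_period hτ, sub_eq_zero]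
  simp only [mul_ite, mul_zero, Finset.sum_ite_eq]
  push_cast
  rw [Finset.mul_sum]
  refine Finset.sum_congr rfl fun i hi => ?_
  rw [if_pos hi, Complex.mul_conj']
  ring

/-- The energy on `[-Ω, Ω]` of a trigonometric polynomial with `m + 1` terms controls its
coefficients. -/
theorem sum_normSq_le_integral_trigPoly {τ Ω : ℝ} (hτ : 0 < τ) (hΩ : 0 < Ω) (s : Finset ℤ)
    (c : ℤ → ℂ) (m P : ℕ) (hs : s.card ≤ m + 1) (hP : ((m : ℝ) + 1) * SRF τ Ω ≤ P) :
    2 * Real.pi / τ * ∑ j ∈ s, ‖c j‖ ^ 2 ≤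
      4 ^ (m + 1) * (P : ℝ) ^ (2 * m + 1) * ((m : ℝ) + 1) *
        ∫ ω in (-Ω)..Ω, ‖trigPoly τ s c ω‖ ^ 2 := by
  set h : ℝ := 2 * Ω / (m + 1) with hh
  have hm : (0 : ℝ) < m + 1 := by positivity
  have hpos : 0 < h := by positivity
  set g : ℝ → ℝ := fun ω => ‖trigPoly τ s c ω‖ ^ 2 with hg
  have hgc : Continuous g := ((continuous_trigPoly τ s c).norm).pow 2
  -- The window is `m + 1` cells of length `h`, and a period is `SRF` windows, so `P` cells cover a
  -- period.
  have hper : 2 * Real.pi / τ ≤ P * h := by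
    have : 2 * Real.pi / τ = (((m : ℝ) + 1) * SRF τ Ω) * h := by
      rw [hh, SRF]
      field_simp
    rw [this]
    gcongr
  have hlow : ∑ l ∈ Finset.range (m + 1), ∫ ω in (-Ω)..(-Ω) + h, g (ω + l * h) =
      ∫ ω in (-Ω)..Ω, g ω := by
    rw [sum_integral_shift hgc]
    congr 1
    rw [hh]
    push_cast
    field_simp
    ring
  have hint : ∀ q : ℕ, IntervalIntegrable (fun ω => g (ω + q * h)) volume (-Ω) (-Ω + h) :=
    fun q => (hgc.comp (by fun_prop)).intervalIntegrable _ _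
  -- Turán's bound is integrated over the first cell only: its `m + 1` translates on the right
  -- reassemble the whole window.
  have hterm : ∀ p ∈ Finset.range P, ∫ ω in (-Ω)..(-Ω) + h, g (ω + p * h) ≤
      4 ^ (m + 1) * (P : ℝ) ^ (2 * m) * ((m : ℝ) + 1) * ∫ ω in (-Ω)..Ω, g ω := by
    intro p hp
    have hpP : (p : ℝ) + 1 ≤ P := by exact_mod_cast Finset.mem_range.1 hp
    rw [← hlow, ← intervalIntegral.integral_finsetSum fun l _ => hint l,
      ← intervalIntegral.integral_const_mul]
    refine intervalIntegral.integral_mono_on (by linarith) (hint p)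
      ((Continuous.const_mul (continuous_finsetSum _ fun l _ => hgc.comp (by fun_prop))
        _).intervalIntegrable _ _) fun ω _ => ?_
    refine (normSq_trigPoly_add_mul_le τ s c ω h p m hs).trans ?_
    gcongr
  calc 2 * Real.pi / τ * ∑ j ∈ s, ‖c j‖ ^ 2
      = ∫ ω in (-Ω)..(-Ω) + 2 * Real.pi / τ, g ω := (integral_normSq_trigPoly hτ s c _).symm
    _ ≤ ∫ ω in (-Ω)..(-Ω) + P * h, g ω :=
        intervalIntegral.integral_mono_interval le_rfl
          (by have := Real.pi_pos; simp only [le_add_iff_nonneg_right]; positivity) (by linarith)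
          (Filter.Eventually.of_forall fun ω => by positivity) (hgc.intervalIntegrable _ _)
    _ = ∑ p ∈ Finset.range P, ∫ ω in (-Ω)..(-Ω) + h, g (ω + p * h) :=
        (sum_integral_shift hgc _ _ _).symm
    _ ≤ ∑ _p ∈ Finset.range P,
          4 ^ (m + 1) * (P : ℝ) ^ (2 * m) * ((m : ℝ) + 1) * ∫ ω in (-Ω)..Ω, g ω :=
        Finset.sum_le_sum hterm
    _ = _ := by
        rw [Finset.sum_const, Finset.card_range, nsmul_eq_mul]
        ring

/-! ### Sparsity and binomial vectors -/

theorem sparsity_sub_le {𝕜 : Type} [RCLike 𝕜] {J : Finset ℤ} (x y : EuclideanSpace 𝕜 J) :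
    sparsity (x - y) ≤ sparsity x + sparsity y := by
  refine (Set.ncard_le_ncard (t := {j : J | x j ≠ 0} ∪ {j : J | y j ≠ 0}) (fun j hj => ?_)
    (Set.toFinite _)).trans (Set.ncard_union_le _ _)
  by_contra h
  simp only [Set.mem_union, Set.mem_ofPred_eq, not_or, not_not] at h
  exact hj (by rw [PiLp.sub_apply, h.1, h.2, sub_zero])

/-- The signed binomial coefficients of order `m`, starting at the grid index `a` and restricted to
`[lo, hi)`. -/
noncomputable def binomVec (𝕜 : Type) [RCLike 𝕜] (J : Finset ℤ) (a : ℤ) (m : ℕ) (lo hi : ℤ) :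
    EuclideanSpace 𝕜 J :=
  WithLp.toLp 2 fun j : J => if (j : ℤ) ∈ Finset.Ico lo hi then
    (((-1) ^ (j - a).toNat * (m.choose (j - a).toNat : ℤ) : ℤ) : 𝕜) else 0

theorem binomVec_apply (𝕜 : Type) [RCLike 𝕜] (J : Finset ℤ) (a : ℤ) (m : ℕ) (lo hi : ℤ) (j : J) :
    binomVec 𝕜 J a m lo hi j = if (j : ℤ) ∈ Finset.Ico lo hi then
      (((-1) ^ (j - a).toNat * (m.choose (j - a).toNat : ℤ) : ℤ) : 𝕜) else 0 := rfl

/-- The signal class requires exactly `k` nonzero entries; no binomial coefficient vanishes while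
`[lo, hi)` stays within `a, …, a + m`. -/
theorem sparsity_smul_binomVec {𝕜 : Type} [RCLike 𝕜] {J : Finset ℤ} {a : ℤ} {m : ℕ} {lo hi : ℤ}
    (hlo : a ≤ lo) (hhi : hi ≤ a + m + 1) (hJ : Finset.Ico lo hi ⊆ J) {r : 𝕜} (hr : r ≠ 0) :
    sparsity (r • binomVec 𝕜 J a m lo hi) = (hi - lo).toNat := by
  have hset : Subtype.val '' {j : J | (r • binomVec 𝕜 J a m lo hi) j ≠ 0} =
      (Finset.Ico lo hi : Set ℤ) := by
    ext j
    simp only [Set.mem_image, Set.mem_ofPred_eq, PiLp.smul_apply, smul_eq_mul, binomVec_apply,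
      Subtype.exists, exists_and_right, exists_eq_right, Finset.mem_coe]
    constructor
    · rintro ⟨hj, h⟩
      by_contra hn
      exact h (by rw [if_neg hn, mul_zero])
    · intro hj
      refine ⟨hJ hj, mul_ne_zero hr ?_⟩
      rw [if_pos hj, Int.cast_ne_zero]
      have h2 := Finset.mem_Ico.1 hj
      have : 0 < m.choose (j - a).toNat := Nat.choose_pos (by omega)
      exact mul_ne_zero (pow_ne_zero _ (by norm_num)) (by exact_mod_cast this.ne')
  rw [sparsity, ← Set.ncard_image_of_injective _ Subtype.val_injective, hset,
    Set.ncard_coe_finset, Int.card_Ico]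

theorem binomVec_add {𝕜 : Type} [RCLike 𝕜] {J : Finset ℤ} {a : ℤ} {m : ℕ} {lo mid hi : ℤ}
    (h1 : lo ≤ mid) (h2 : mid ≤ hi) :
    binomVec 𝕜 J a m lo mid + binomVec 𝕜 J a m mid hi = binomVec 𝕜 J a m lo hi := by
  ext j
  simp only [PiLp.add_apply, binomVec_apply, Finset.mem_Ico]
  split_ifs <;> first | omega | simp

theorem one_le_norm_binomVec {𝕜 : Type} [RCLike 𝕜] {J : Finset ℤ} {a : ℤ} (m : ℕ) {hi : ℤ}
    (ha : a ∈ J) (hhi : a < hi) : 1 ≤ ‖binomVec 𝕜 J a m a hi‖ := by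
  refine le_trans (le_of_eq ?_) (PiLp.norm_apply_le (binomVec 𝕜 J a m a hi) ⟨a, ha⟩)
  rw [binomVec_apply]
  simp [hhi]

/-! ### The synthesis operator as a trigonometric polynomial -/

variable {𝕜 : Type} [RCLike 𝕜] [NormedSpace 𝕜 ℂ]

/-- The coefficients of `x`, as complex numbers, extended by zero to all grid indices. -/
noncomputable def coeff {J : Finset ℤ} (x : EuclideanSpace 𝕜 J) (j : ℤ) : ℂ :=
  if h : j ∈ J then x ⟨j, h⟩ • (1 : ℂ) else 0

theorem coeff_coe {J : Finset ℤ} (x : EuclideanSpace 𝕜 J) (j : J) :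
    coeff x j = x j • (1 : ℂ) := by
  simp [coeff]

theorem norm_sq_toLp_eq_integral {Ω : ℝ} (hΩ : 0 < Ω) {f : ℝ → ℂ}
    (hf : MemLp f 2 (volume.restrict (Icc (-Ω) Ω))) :
    ‖hf.toLp f‖ ^ 2 = ∫ ω in (-Ω)..Ω, ‖f ω‖ ^ 2 := by
  rw [Lp.norm_toLp, hf.eLpNorm_eq_integral_rpow_norm (by norm_num) (by norm_num),
    ENNReal.toReal_ofReal (by positivity), intervalIntegral.integral_of_le (by linarith),
    ← integral_Icc_eq_integral_Ioc, ← Real.rpow_natCast, ← Real.rpow_mul (by positivity)]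
  simp

theorem norm_sq_synthesis [IsScalarTower 𝕜 ℂ ℂ] {τ Ω : ℝ} (hΩ : 0 < Ω) {J : Finset ℤ}
    (x : EuclideanSpace 𝕜 J) :
    ‖synthesis τ Ω J x‖ ^ 2 = (∫ ω in (-Ω)..Ω, ‖trigPoly τ J (coeff x) ω‖ ^ 2) / (2 * Ω) := by
  set f : ℝ → ℂ := fun ω => trigPoly τ J (coeff x) ω / ((Real.sqrt (2 * Ω) : ℝ) : ℂ) with hf
  have hae : synthesis τ Ω J x =ᵐ[volume.restrict (Icc (-Ω) Ω)] f := by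
    have h1 : ∀ j : J, (x j • atom τ Ω (j : ℤ) : DataSpace Ω)
        =ᵐ[volume.restrict (Icc (-Ω) Ω)] fun ω => x j • atomFun τ Ω j ω := fun j =>
      (Lp.coeFn_smul _ _).trans ((memLp_atomFun τ Ω j).coeFn_toLp.const_smul (x j))
    have h2 := ae_all_iff.2 h1
    filter_upwards [Lp.coeFn_finsetSum (Finset.univ : Finset J)
      (fun j : J => (x j • atom τ Ω (j : ℤ) : DataSpace Ω)), h2] with ω hω hω'
    rw [synthesis, hω, Finset.sum_apply]
    simp only [hω', hf, trigPoly]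
    rw [← Finset.sum_coe_sort J, Finset.sum_div]
    refine Finset.sum_congr rfl fun j _ => ?_
    rw [coeff_coe, atomFun, mul_div_assoc, smul_mul_assoc, one_mul]
  have hmem : MemLp f 2 (volume.restrict (Icc (-Ω) Ω)) := (Lp.memLp _).ae_eq hae
  have heq : synthesis τ Ω J x = hmem.toLp f := Lp.ext (hae.trans hmem.coeFn_toLp.symm)
  rw [heq, norm_sq_toLp_eq_integral hΩ, ← intervalIntegral.integral_div]
  refine intervalIntegral.integral_congr fun ω _ => ?_
  simp only [hf]
  rw [norm_div, div_pow, Complex.norm_real, Real.norm_of_nonneg (Real.sqrt_nonneg _),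
    Real.sq_sqrt (by linarith)]

theorem norm_coeff_coe {J : Finset ℤ} (x : EuclideanSpace 𝕜 J) (j : J) :
    ‖coeff x j‖ = ‖x j‖ := by
  rw [coeff_coe, norm_smul, norm_one, mul_one]

theorem synthesis_sub {τ Ω : ℝ} {J : Finset ℤ} (x y : EuclideanSpace 𝕜 J) :
    synthesis τ Ω J (x - y) = synthesis τ Ω J x - synthesis τ Ω J y := by
  simp only [synthesis, ← Finset.sum_sub_distrib, PiLp.sub_apply, sub_smul]

theorem synthesis_smul {τ Ω : ℝ} {J : Finset ℤ} (r : 𝕜) (x : EuclideanSpace 𝕜 J) :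
    synthesis τ Ω J (r • x) = r • synthesis τ Ω J x := by
  simp only [synthesis, Finset.smul_sum, PiLp.smul_apply, smul_eq_mul, mul_smul]

/-- The factor `SRF` on the left is the ratio of the period to the window length, left over from the
normalisation of the atoms. -/
theorem norm_sq_le_norm_sq_synthesis [IsScalarTower 𝕜 ℂ ℂ] {τ Ω : ℝ} (hτ : 0 < τ) (hΩ : 0 < Ω)
    {J : Finset ℤ} (x : EuclideanSpace 𝕜 J) (m P : ℕ) (hx : sparsity x ≤ m + 1)
    (hP : ((m : ℝ) + 1) * SRF τ Ω ≤ P) :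
    SRF τ Ω * ‖x‖ ^ 2 ≤
      4 ^ (m + 1) * (P : ℝ) ^ (2 * m + 1) * ((m : ℝ) + 1) * ‖synthesis τ Ω J x‖ ^ 2 := by
  classical
  set s := J.filter fun j => coeff x j ≠ 0 with hs
  have hpoly : trigPoly τ s (coeff x) = trigPoly τ J (coeff x) := by
    ext ω
    refine Finset.sum_subset (Finset.filter_subset _ _) fun j hj hjs => ?_
    have : coeff x j = 0 := by
      by_contra h
      exact hjs (Finset.mem_filter.2 ⟨hj, h⟩)
    rw [this, zero_mul]
  have hnorm : ∑ j ∈ s, ‖coeff x j‖ ^ 2 = ‖x‖ ^ 2 := by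
    have hne : ∀ j ∈ J, ‖coeff x j‖ ^ 2 ≠ 0 → coeff x j ≠ 0 := fun j _ h h0 => h (by simp [h0])
    rw [EuclideanSpace.norm_sq_eq, hs, Finset.sum_filter_of_ne hne, ← Finset.sum_coe_sort J]
    exact Finset.sum_congr rfl fun j _ => by rw [norm_coeff_coe]
  have hcard : s.card ≤ m + 1 := by
    refine le_trans (le_of_eq ?_) hx
    rw [sparsity, ← Set.ncard_image_of_injective _ Subtype.val_injective, ← Set.ncard_coe_finset]
    congr 1
    ext j
    simp only [hs, Finset.coe_filter, Set.mem_ofPred_eq, Set.mem_image, Subtype.exists,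
      exists_and_right, exists_eq_right]
    refine ⟨fun ⟨hj, h⟩ => ⟨hj, fun h0 => h ?_⟩, fun ⟨hj, h⟩ => ⟨hj, fun h0 => h ?_⟩⟩
    · rw [coeff_coe x ⟨j, hj⟩, h0, zero_smul]
    · rw [← norm_eq_zero, ← norm_coeff_coe, h0, norm_zero]
  have key := sum_normSq_le_integral_trigPoly hτ hΩ s (coeff x) m P hcard hP
  rw [hpoly, hnorm] at key
  rw [norm_sq_synthesis hΩ]
  calc SRF τ Ω * ‖x‖ ^ 2 = (2 * Real.pi / τ * ‖x‖ ^ 2) / (2 * Ω) := by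
        rw [SRF]
        field_simp
    _ ≤ (4 ^ (m + 1) * (P : ℝ) ^ (2 * m + 1) * ((m : ℝ) + 1) *
          ∫ ω in (-Ω)..Ω, ‖trigPoly τ J (coeff x) ω‖ ^ 2) / (2 * Ω) := by gcongr
    _ = _ := mul_div_assoc _ _ _

/-! ### Stability of sparse vectors and the upper bound -/

/-- The constant in the stability estimate for `2k`-sparse vectors. -/
noncomputable def stabilityConst (k : ℕ) : ℝ :=
  Real.sqrt (16 ^ k * (3 * k) ^ (4 * k - 1) * (2 * k))

theorem norm_le_norm_synthesis [IsScalarTower 𝕜 ℂ ℂ] {τ Ω : ℝ} (hτ : 0 < τ) (hΩ : 0 < Ω)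
    (hS : 2 < SRF τ Ω) {J : Finset ℤ} {k : ℕ} (hk : 0 < k) (x : EuclideanSpace 𝕜 J)
    (hx : sparsity x ≤ 2 * k) :
    ‖x‖ ≤ stabilityConst k * SRF τ Ω ^ (2 * k - 1) * ‖synthesis τ Ω J x‖ := by
  obtain ⟨n, rfl⟩ : ∃ n, k = n + 1 := ⟨k - 1, by omega⟩
  set S := SRF τ Ω with hSdef
  have hS0 : 0 < S := by linarith
  have hn : (0 : ℝ) ≤ n := Nat.cast_nonneg n
  -- With `k = n + 1`, rounding `2kS` up costs less than `1 ≤ kS`, because `S > 2`.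
  have hP2 : (⌈((2 * n + 1 : ℕ) + 1 : ℝ) * S⌉₊ : ℝ) ≤ 3 * (n + 1 : ℕ) * S := by
    refine (Nat.ceil_lt_add_one (by positivity)).le.trans ?_
    push_cast
    nlinarith [mul_nonneg hn hS0.le]
  have key := norm_sq_le_norm_sq_synthesis hτ hΩ x (2 * n + 1) _ hx (Nat.le_ceil _)
  refine abs_le_of_sq_le_sq' ?_ ?_ |>.2
  · rw [mul_pow, mul_pow, stabilityConst, Real.sq_sqrt (by positivity)]
    -- Cancelling one `S` lowers the exponent from `4k - 1` to `4k - 2`, the square of the desired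
    -- power.
    refine le_of_mul_le_mul_left ?_ hS0
    calc S * ‖x‖ ^ 2 ≤ _ := key
      _ ≤ 4 ^ (2 * n + 1 + 1) * (3 * (n + 1 : ℕ) * S) ^ (2 * (2 * n + 1) + 1) *
            (((2 * n + 1 : ℕ) : ℝ) + 1) * ‖synthesis τ Ω J x‖ ^ 2 := by gcongr
      _ = _ := by
        have e1 : 4 * (n + 1) - 1 = 4 * n + 3 := by omega
        have e2 : 2 * (n + 1) - 1 = 2 * n + 1 := by omega
        have e3 : (16 : ℝ) = 4 ^ 2 := by norm_num
        have e4 : 2 * (2 * n + 1) + 1 = 4 * n + 3 := by omega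
        rw [e1, e2, e3, e4, mul_pow _ S, ← pow_mul, ← pow_mul]
        push_cast
        ring
  · have : 0 ≤ stabilityConst (n + 1) := Real.sqrt_nonneg _
    positivity

theorem minimaxErrorLe_le [IsScalarTower 𝕜 ℂ ℂ] {τ Ω σ : ℝ} (hτ : 0 < τ) (hΩ : 0 < Ω)
    (hS : 2 < SRF τ Ω) {J : Finset ℤ} {k : ℕ} (hk : 0 < k) :
    minimaxErrorLe 𝕜 τ Ω J k σ ≤
      ENNReal.ofReal (2 * stabilityConst k * SRF τ Ω ^ (2 * k - 1) * σ) := by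
  classical
  -- Any `k`-sparse vector consistent with the data will do. The default `0` is never used on
  -- admissible data, since the true signal is consistent.
  let est : DataSpace Ω → EuclideanSpace 𝕜 J := fun f =>
    if h : ∃ y : EuclideanSpace 𝕜 J, sparsity y = k ∧ ‖f - synthesis τ Ω J y‖ ≤ σ
    then h.choose else 0
  refine iInf_le_of_le est (iSup₂_le fun x hx => iSup₂_le fun e he => ENNReal.ofReal_le_ofReal ?_)
  have hex : ∃ y : EuclideanSpace 𝕜 J, sparsity y = k ∧
      ‖synthesis τ Ω J x + e - synthesis τ Ω J y‖ ≤ σ := ⟨x, hx, by simpa using he⟩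
  have hest : est (synthesis τ Ω J x + e) = hex.choose := dif_pos hex
  rw [hest]
  set y := hex.choose
  obtain ⟨hy, hyσ⟩ := hex.choose_spec
  have hA : ‖synthesis τ Ω J (y - x)‖ ≤ 2 * σ := by
    have he' : ‖e‖ ≤ σ := he
    have : synthesis τ Ω J (y - x) = e - (synthesis τ Ω J x + e - synthesis τ Ω J y) := by
      rw [synthesis_sub]
      abel
    rw [this]
    refine (norm_sub_le _ _).trans ?_
    change ‖synthesis τ Ω J x + e - synthesis τ Ω J y‖ ≤ σ at hyσ
    linarith
  have hsp : sparsity (y - x) ≤ 2 * k := (sparsity_sub_le y x).trans (by rw [hy, hx]; omega)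
  have : 0 ≤ stabilityConst k := Real.sqrt_nonneg _
  have hS0 : 0 < SRF τ Ω := by linarith
  calc ‖y - x‖ ≤ stabilityConst k * SRF τ Ω ^ (2 * k - 1) * ‖synthesis τ Ω J (y - x)‖ :=
        norm_le_norm_synthesis hτ hΩ hS hk _ hsp
    _ ≤ stabilityConst k * SRF τ Ω ^ (2 * k - 1) * (2 * σ) := by gcongr
    _ = _ := by ring

theorem minimaxErrorEq_le_minimaxErrorLe (τ Ω : ℝ) (J : Finset ℤ) (k : ℕ) (σ : ℝ) :
    minimaxErrorEq 𝕜 τ Ω J k σ ≤ minimaxErrorLe 𝕜 τ Ω J k σ :=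
  iInf_mono fun _ => iSup₂_mono fun _ _ => biSup_mono fun _ he => le_of_eq he

/-! ### The lower bound -/

theorem trigPoly_coeff_binomVec (τ : ℝ) {J : Finset ℤ} {a : ℤ} {m : ℕ}
    (hJ : Finset.Ico a (a + (m + 1 : ℕ)) ⊆ J) (ω : ℝ) :
    trigPoly τ J (coeff (binomVec 𝕜 J a m a (a + (m + 1 : ℕ)))) ω =
      Complex.exp (Complex.I * (a : ℂ) * (τ : ℂ) * (ω : ℂ)) *
        (1 - Complex.exp (Complex.I * ((τ * ω : ℝ) : ℂ))) ^ m := by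
  set E : ℂ := Complex.exp (Complex.I * ((τ * ω : ℝ) : ℂ)) with hE
  have hc : ∀ j ∈ J, coeff (binomVec 𝕜 J a m a (a + (m + 1 : ℕ))) j =
      if j ∈ Finset.Ico a (a + (m + 1 : ℕ)) then
        (((-1) ^ (j - a).toNat * (m.choose (j - a).toNat : ℤ) : ℤ) : ℂ) else 0 := by
    intro j hj
    rw [coeff_coe _ ⟨j, hj⟩, binomVec_apply]
    simp only
    split_ifs
    · rw [Int.cast_smul_eq_zsmul, zsmul_eq_mul, mul_one]
    · exact zero_smul _ _
  have himg : Finset.Ico a (a + (m + 1 : ℕ)) =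
      (Finset.range (m + 1)).image fun i : ℕ => a + (i : ℤ) := by
    ext j
    simp only [Finset.mem_Ico, Finset.mem_image, Finset.mem_range]
    exact ⟨fun h => ⟨(j - a).toNat, by omega, by omega⟩, by rintro ⟨i, hi, rfl⟩; omega⟩
  rw [trigPoly, ← Finset.sum_subset hJ fun j hj hn => by rw [hc j hj, if_neg hn, zero_mul],
    Finset.sum_congr rfl fun j hj => by rw [hc j (hJ hj), if_pos hj], himg,
    Finset.sum_image fun i _ j _ h => by simpa using h, sub_eq_neg_add, add_pow, Finset.mul_sum]
  refine Finset.sum_congr rfl fun i _ => ?_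
  have hexp : Complex.exp (Complex.I * ((a + (i : ℤ) : ℤ) : ℂ) * (τ : ℂ) * (ω : ℂ)) =
      Complex.exp (Complex.I * (a : ℂ) * (τ : ℂ) * (ω : ℂ)) * E ^ i := by
    rw [hE, ← Complex.exp_nat_mul, ← Complex.exp_add]
    push_cast
    ring_nf
  rw [hexp, add_sub_cancel_left, Int.toNat_natCast, one_pow, neg_pow]
  push_cast
  ring

/-- On the window `|1 - exp(iτω)| ≤ τ|ω| ≤ τΩ`, and the unit atoms turn the `L²` norm into a root
mean square. -/
theorem norm_synthesis_binomVec_le [IsScalarTower 𝕜 ℂ ℂ] {τ Ω : ℝ} (hτ : 0 < τ) (hΩ : 0 < Ω)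
    {J : Finset ℤ} {a : ℤ} {m : ℕ} (hJ : Finset.Ico a (a + (m + 1 : ℕ)) ⊆ J) :
    ‖synthesis τ Ω J (binomVec 𝕜 J a m a (a + (m + 1 : ℕ)))‖ ≤ (τ * Ω) ^ m := by
  refine abs_le_of_sq_le_sq' ?_ (by positivity) |>.2
  rw [norm_sq_synthesis hΩ, div_le_iff₀ (by positivity)]
  have hbound : ∀ ω ∈ Icc (-Ω) Ω,
      ‖trigPoly τ J (coeff (binomVec 𝕜 J a m a (a + (m + 1 : ℕ)))) ω‖ ^ 2 ≤
        ((τ * Ω) ^ m) ^ 2 := by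
    intro ω hω
    rw [trigPoly_coeff_binomVec τ hJ, norm_mul, norm_exp_I_mul_int_mul, one_mul, norm_pow]
    have h1 : ‖1 - Complex.exp (Complex.I * ((τ * ω : ℝ) : ℂ))‖ ≤ τ * Ω := by
      rw [norm_sub_rev]
      refine Real.norm_exp_I_mul_ofReal_sub_one_le.trans ?_
      rw [Real.norm_eq_abs, abs_mul, abs_of_pos hτ]
      gcongr
      exact abs_le.2 hω
    gcongr
  calc _ ≤ ∫ _ω in (-Ω)..Ω, ((τ * Ω) ^ m) ^ 2 :=
        intervalIntegral.integral_mono_on (by linarith)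
          (((continuous_trigPoly _ _ _).norm.pow 2).intervalIntegrable _ _)
          (continuous_const.intervalIntegrable _ _) hbound
    _ = _ := by
        rw [intervalIntegral.integral_const, smul_eq_mul]
        ring

theorem le_minimaxErrorEq [IsScalarTower 𝕜 ℂ ℂ] {τ Ω σ : ℝ} (hτ : 0 < τ) (hΩ : 0 < Ω)
    (hσ : 0 < σ) (hS : 2 < SRF τ Ω) {J : Finset ℤ} {k : ℕ} (hk : 0 < k) {a : ℤ}
    (hJ : Finset.Ico a (a + 2 * (k : ℤ)) ⊆ J) :
    ENNReal.ofReal ((1 / Real.pi) ^ (2 * k - 1) * SRF τ Ω ^ (2 * k - 1) * σ) ≤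
      minimaxErrorEq 𝕜 τ Ω J k σ := by
  set m := 2 * k - 1 with hm
  have hend : a + 2 * (k : ℤ) = a + (m + 1 : ℕ) := by omega
  rw [hend] at hJ
  set x₁ := binomVec 𝕜 J a m a (a + k)
  set x₂ := binomVec 𝕜 J a m (a + k) (a + (m + 1 : ℕ))
  set u := binomVec 𝕜 J a m a (a + (m + 1 : ℕ)) with hu
  have hadd : x₁ + x₂ = u := binomVec_add (by omega) (by omega)
  have hu1 : 1 ≤ ‖u‖ :=
    one_le_norm_binomVec m (hJ (Finset.mem_Ico.2 ⟨le_rfl, by omega⟩)) (by omega)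
  have huA := norm_synthesis_binomVec_le (𝕜 := 𝕜) hτ hΩ hJ
  rw [← hu] at huA
  set N := ‖synthesis τ Ω J u‖ with hN
  -- Stability excludes `A u = 0`; this permits scaling the noise to norm exactly `σ`.
  have hNpos : 0 < N := by
    have hsp : sparsity u ≤ 2 * k := by
      have := sparsity_smul_binomVec (𝕜 := 𝕜) le_rfl (by omega : a + (m + 1 : ℕ) ≤ a + m + 1) hJ
        one_ne_zero
      rw [one_smul] at this
      rw [hu, this]
      omega
    have h := norm_le_norm_synthesis hτ hΩ hS hk u hsp
    refine (norm_nonneg _).lt_of_ne fun h0 => ?_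
    rw [← h0, mul_zero] at h
    linarith
  -- This scaling puts the images of `y₁` and `y₂` at distance `2σ`; their midpoint is then the
  -- common data, with noise `-d` and `d`.
  set r : ℝ := 2 * σ / N with hr
  have hr0 : 0 < r := by positivity
  have hr𝕜 : ((r : ℝ) : 𝕜) ≠ 0 := by exact_mod_cast hr0.ne'
  have hnr : ‖((r : ℝ) : 𝕜)‖ = r := by rw [RCLike.norm_ofReal, abs_of_pos hr0]
  set y₁ := ((r : ℝ) : 𝕜) • x₁ with hy₁
  set y₂ := (-((r : ℝ) : 𝕜)) • x₂ with hy₂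
  have hy : y₁ - y₂ = ((r : ℝ) : 𝕜) • u := by
    rw [hy₁, hy₂, ← hadd]
    module
  have hs₁ : sparsity y₁ = k := by
    rw [hy₁, sparsity_smul_binomVec le_rfl (by omega)
      ((Finset.Ico_subset_Ico_right (by omega)).trans hJ) hr𝕜]
    omega
  have hs₂ : sparsity y₂ = k := by
    rw [hy₂, sparsity_smul_binomVec (by omega) (by omega)
      ((Finset.Ico_subset_Ico_left (by omega)).trans hJ) (neg_ne_zero.2 hr𝕜)]
    omega
  set d : DataSpace Ω := (2⁻¹ : ℂ) • (synthesis τ Ω J y₁ - synthesis τ Ω J y₂) with hd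
  have hdσ : ‖d‖ = σ := by
    rw [hd, ← synthesis_sub, hy, synthesis_smul, norm_smul, norm_smul, hnr, ← hN, norm_inv,
      Complex.norm_ofNat, hr]
    field_simp
  have hdata : synthesis τ Ω J y₁ + -d = synthesis τ Ω J y₂ + d := by
    rw [hd]
    module
  -- `τΩ = π / SRF` is the source of the constant `(1 / π) ^ (2k-1)`; the factor `2` is lost below,
  -- as one of the two errors is at least half the distance.
  have hdist : 2 * ((1 / Real.pi) ^ m * SRF τ Ω ^ m * σ) ≤ ‖y₁ - y₂‖ := by
    have hτΩ : 0 < τ * Ω := by positivity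
    calc 2 * ((1 / Real.pi) ^ m * SRF τ Ω ^ m * σ) = 2 * σ / (τ * Ω) ^ m := by
          rw [← mul_pow, SRF, one_div_mul_eq_div, div_div_cancel_left' Real.pi_ne_zero, inv_pow]
          ring
      _ ≤ r := by rw [hr]; gcongr
      _ ≤ r * ‖u‖ := le_mul_of_one_le_right hr0.le hu1
      _ = ‖y₁ - y₂‖ := by rw [hy, norm_smul, hnr]
  refine le_iInf fun est => ?_
  have hle : ∀ (y : EuclideanSpace 𝕜 J) (e : DataSpace Ω), sparsity y = k → ‖e‖ = σ →
      ENNReal.ofReal ‖est (synthesis τ Ω J y + e) - y‖ ≤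
        ⨆ x : EuclideanSpace 𝕜 J, ⨆ _ : sparsity x = k, ⨆ e : DataSpace Ω,
          ⨆ _ : e ∈ {e : DataSpace Ω | ‖e‖ = σ},
            ENNReal.ofReal ‖est (synthesis τ Ω J x + e) - x‖ :=
    fun y e hy he => le_iSup₂_of_le y hy (le_iSup₂_of_le e he le_rfl)
  have htri : ‖y₁ - y₂‖ ≤ ‖est (synthesis τ Ω J y₁ + -d) - y₁‖ +
      ‖est (synthesis τ Ω J y₂ + d) - y₂‖ := by
    rw [hdata, ← norm_sub_rev y₁]
    exact norm_sub_le_norm_sub_add_norm_sub _ _ _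
  rcases le_total ‖est (synthesis τ Ω J y₁ + -d) - y₁‖ ‖est (synthesis τ Ω J y₂ + d) - y₂‖ with h | h
  · exact (ENNReal.ofReal_le_ofReal (by linarith)).trans (hle y₂ d hs₂ hdσ)
  · exact (ENNReal.ofReal_le_ofReal (by linarith)).trans (hle y₁ (-d) hs₁ (by rw [norm_neg, hdσ]))

theorem stabilityConst_pos {k : ℕ} (hk : 0 < k) : 0 < stabilityConst k := by
  have : (0 : ℝ) < k := by exact_mod_cast hk
  exact Real.sqrt_pos.2 (by positivity)

theorem scalesLike_minimaxErrors [IsScalarTower 𝕜 ℂ ℂ] {τ Ω σ : ℝ} (hτ : 0 < τ) (hΩ : 0 < Ω)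
    (hσ : 0 < σ) (hS : 2 < SRF τ Ω) {J : Finset ℤ} {k : ℕ} (hk : 0 < k) {a : ℤ}
    (hJ : Finset.Ico a (a + 2 * (k : ℤ)) ⊆ J) :
    ScalesLike ((1 / Real.pi) ^ (2 * k - 1)) (2 * stabilityConst k) τ Ω k σ
        (minimaxErrorEq 𝕜 τ Ω J k σ) ∧
      ScalesLike ((1 / Real.pi) ^ (2 * k - 1)) (2 * stabilityConst k) τ Ω k σ
        (minimaxErrorLe 𝕜 τ Ω J k σ) := by
  have h1 := le_minimaxErrorEq (𝕜 := 𝕜) hτ hΩ hσ hS hk hJ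
  have h2 := minimaxErrorEq_le_minimaxErrorLe (𝕜 := 𝕜) τ Ω J k σ
  have h3 := minimaxErrorLe_le (𝕜 := 𝕜) (σ := σ) hτ hΩ hS (J := J) hk
  exact ⟨⟨h1, h2.trans h3⟩, ⟨h1.trans h2, h3⟩⟩

end Superresolution

/-- For every `k ≥ 1` there are positive constants, depending only on `k`, such that the minimax
error scales like `SRF^(2k-1) σ`, for all `τ, Ω > 0` with `SRF > 2`, all noise levels `σ > 0`, and
all finite sets `J` of grid indices that contain `2k` consecutive integers; for real and for complex
coefficient vectors, and for noise of norm exactly `σ` as well as at most `σ`. -/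
theorem mainTheorem1 (k : ℕ) (hk : 0 < k) :
    ∃ C₁ C₂ : ℝ, 0 < C₁ ∧ 0 < C₂ ∧
      ∀ (τ Ω σ : ℝ) (J : Finset ℤ), 0 < τ → 0 < Ω → 0 < σ →
        2 < Superresolution.SRF τ Ω →
        (∃ a : ℤ, Finset.Ico a (a + 2 * (k : ℤ)) ⊆ J) →
          Superresolution.ScalesLike C₁ C₂ τ Ω k σ (Superresolution.minimaxErrorEq ℝ τ Ω J k σ) ∧
          Superresolution.ScalesLike C₁ C₂ τ Ω k σ (Superresolution.minimaxErrorEq ℂ τ Ω J k σ) ∧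
          Superresolution.ScalesLike C₁ C₂ τ Ω k σ (Superresolution.minimaxErrorLe ℝ τ Ω J k σ) ∧
          Superresolution.ScalesLike C₁ C₂ τ Ω k σ (Superresolution.minimaxErrorLe ℂ τ Ω J k σ) := by
  refine ⟨(1 / Real.pi) ^ (2 * k - 1), 2 * Superresolution.stabilityConst k,
    by have := Real.pi_pos; positivity,
    mul_pos two_pos (Superresolution.stabilityConst_pos hk), ?_⟩
  rintro τ Ω σ J hτ hΩ hσ hS ⟨a, hJ⟩
  obtain ⟨hR, hR'⟩ := Superresolution.scalesLike_minimaxErrors (𝕜 := ℝ) hτ hΩ hσ hS hk hJ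
  obtain ⟨hC, hC'⟩ := Superresolution.scalesLike_minimaxErrors (𝕜 := ℂ) hτ hΩ hσ hS hk hJ
  exact ⟨hR, hC, hR', hC'⟩
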